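/- Let $\Omega\subset\mathbb R^n$ be a bounded domain (open, connected, nonempty), fix the homogeneous Dirichlet or the homogeneous Neumann boundary condition, and let $-\Delta$ act on the functions in $H^2(\Omega)$ satisfying it (the Neumann condition $\partial u/\partial n=0$ is understood as $\int_\Omega(\nabla u\cdot\nabla\psi+\psi\,\Delta u)\,dx=0$ for all $\psi\in H^1(\Omega)$; the Dirichlet condition as $u\in H^1_0(\Omega)$). Consider $$u_t=D_u\Delta u+f(u,v),\qquad v_t=D_v\Delta v+g(u,v)$$ with $D_u,D_v>0$, both components satisfying the boundary condition, where $f,g:\mathbb R^2\to\mathbb R$ are differentiable at $(0,0)$ and $f(0,0)=g(0,0)=0$. Let $A=(a_{ij})=\begin{pmatrix}f_u&f_v\\ g_u&g_v\end{pmatrix}(0,0)$. The system is called *Turing unstable* if every eigenvalue of $A$ has negative real part while the linearized operator $(u,v)\mapsto(D_u\Delta u+a_{11}u+a_{12}v,\;D_v\Delta v+a_{21}u+a_{22}v)$, on complex-valued pairs $(u,v)$ in $H^2(\Omega)^2$ satisfying the boundary condition, has an eigenvalue with positive real part. Assume $\det A>0$ and $\operatorname{Tr}A<0$, and fix $D_u>0$.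 Put $$h(\lambda)=h_{D_v}(\lambda)=D_uD_v\lambda^2-(a_{11}D_v+a_{22}D_u)\lambda+\det A,\qquad M_\lambda=\begin{pmatrix}a_{11}-\lambda D_u&a_{12}\\a_{21}&a_{22}-\lambda D_v\end{pmatrix},$$ $$q=4D_u\det A-2a_{11}a_{22}D_u,\qquad D_v^0=\frac{q+\sqrt{q^2-4a_{11}^2a_{22}^2D_u^2}}{2a_{11}^2},\qquad k_c^0=\frac{a_{11}D_v^0+a_{22}D_u}{2D_uD_v^0},$$ and suppose that $D_v^0$ is well defined and positive. Suppose that $\lambda_i<\lambda_{i+1}$ are two consecutive (distinct) eigenvalues of $-\Delta$ such that $$\lambda_i<k_c^0<\lambda_{i+1},\qquad \det M_{\lambda_i}>0,\qquad \det M_{\lambda_{i+1}}>0,$$ the determinants being taken at $D_v=D_v^0$. For $j\in\{i,i+1\}$ let $D_v^{\lambda_j}$ be the positive root $D_v$ of the equation $h_{D_v}(\lambda_j)=0$ (which is affine in $D_v$), with $D_v^{\lambda_j}=+\infty$ if there is no positive root, and let $$D_v^*=\min\{D_v^{\lambda_i},D_v^{\lambda_{i+1}}\}\in(0,+\infty].$$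 Then, for every $D_v>0$, the system is Turing unstable if and only if $D_v>D_v^*$. -/

import Mathlib

open MeasureTheory Filter Topology
open scoped ContDiff

namespace TuringRD

noncomputable section

/-- `ℝⁿ` with its Euclidean structure. -/
abbrev E (n : ℕ) : Type := EuclideanSpace ℝ (Fin n)

/-- The two homogeneous boundary conditions. -/
inductive BoundaryCondition
  | dirichlet
  | neumann

/-- Classical partial derivative `∂φ/∂xᵢ`. -/
def partialDeriv {n : ℕ} (i : Fin n) (φ : E n → ℂ) (x : E n) : ℂ :=
  fderiv ℝ φ x (EuclideanSpace.single i (1 : ℝ))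

/-- `φ ∈ C_c^∞(Ω)`. -/
def IsTestFunction {n : ℕ} (Ω : Set (E n)) (φ : E n → ℂ) : Prop :=
  ContDiff ℝ ∞ φ ∧ HasCompactSupport φ ∧ tsupport φ ⊆ Ω

/-- `g` is the weak partial derivative `∂u/∂xᵢ` in `Ω`. -/
def HasWeakPartial {n : ℕ} (Ω : Set (E n)) (i : Fin n) (u g : E n → ℂ) : Prop :=
  ∀ φ : E n → ℂ, IsTestFunction Ω φ →
    ∫ x in Ω, u x * partialDeriv i φ x = - ∫ x in Ω, g x * φ x

/-- `u ∈ H¹(Ω)` with weak gradient `G`. -/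
def HasH1Gradient {n : ℕ} (Ω : Set (E n)) (u : E n → ℂ) (G : Fin n → E n → ℂ) : Prop :=
  MemLp u 2 (volume.restrict Ω) ∧
    ∀ i, MemLp (G i) 2 (volume.restrict Ω) ∧ HasWeakPartial Ω i u (G i)

/-- `u` (with weak gradient `G`) lies in `H¹₀(Ω)`, the closure of `C_c^∞(Ω)` in `H¹(Ω)`. -/
def VanishesOnBoundary {n : ℕ} (Ω : Set (E n)) (u : E n → ℂ) (G : Fin n → E n → ℂ) : Prop :=
  ∃ φ : ℕ → E n → ℂ, (∀ k, IsTestFunction Ω (φ k)) ∧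
    Tendsto (fun k => eLpNorm (fun x => φ k x - u x) 2 (volume.restrict Ω)) atTop (𝓝 0) ∧
    ∀ i, Tendsto (fun k => eLpNorm (fun x => partialDeriv i (φ k) x - G i x) 2
      (volume.restrict Ω)) atTop (𝓝 0)

/-- A function with weak gradient `G` and Laplacian `w` has vanishing normal derivative on `∂Ω`,
expressed by Green's formula: `∫_Ω (∇u · ∇ψ + ψ Δu) = ∫_{∂Ω} ψ ∂u/∂n = 0` for all
`ψ ∈ H¹(Ω)`. -/
def NormalDerivVanishes {n : ℕ} (Ω : Set (E n)) (G : Fin n → E n → ℂ) (w : E n → ℂ) : Prop :=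
  ∀ (ψ : E n → ℂ) (Ψ : Fin n → E n → ℂ), HasH1Gradient Ω ψ Ψ →
    ∫ x in Ω, ((∑ i, G i x * Ψ i x) + w x * ψ x) = 0

/-- `u ∈ H²(Ω)` satisfies the boundary condition `bc` and `Δu = w` almost everywhere in `Ω`. -/
def HasLaplacian {n : ℕ} (Ω : Set (E n)) (bc : BoundaryCondition) (u w : E n → ℂ) : Prop :=
  ∃ (G : Fin n → E n → ℂ) (K : Fin n → Fin n → E n → ℂ),
    HasH1Gradient Ω u G ∧ (∀ i, HasH1Gradient Ω (G i) (K i)) ∧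
    w =ᵐ[volume.restrict Ω] (fun x => ∑ i, K i i x) ∧
    match bc with
    | .dirichlet => VanishesOnBoundary Ω u G
    | .neumann => NormalDerivVanishes Ω G w

/-- `lam` is an eigenvalue of `-Δ` on `Ω` under the boundary condition `bc`. -/
def IsLaplaceEigenvalue {n : ℕ} (Ω : Set (E n)) (bc : BoundaryCondition) (lam : ℝ) : Prop :=
  ∃ e w : E n → ℂ, HasLaplacian Ω bc e w ∧ ¬ (e =ᵐ[volume.restrict Ω] 0) ∧
    ∀ᵐ x ∂(volume.restrict Ω), - w x = (lam : ℂ) * e x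

/-- `lam < lam'` are two consecutive terms in the increasing list of eigenvalues of `-Δ`. -/
def AreConsecutiveEigenvalues {n : ℕ} (Ω : Set (E n)) (bc : BoundaryCondition)
    (lam lam' : ℝ) : Prop :=
  IsLaplaceEigenvalue Ω bc lam ∧ IsLaplaceEigenvalue Ω bc lam' ∧ lam < lam' ∧
    ∀ μ : ℝ, IsLaplaceEigenvalue Ω bc μ → μ ≤ lam ∨ lam' ≤ μ

/-- The Jacobian matrix at `(0,0)` of the reaction terms `(f, g)`. -/
def jacobian (f g : ℝ → ℝ → ℝ) : Matrix (Fin 2) (Fin 2) ℝ :=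
  !![deriv (fun u => f u 0) 0, deriv (fun v => f 0 v) 0;
     deriv (fun u => g u 0) 0, deriv (fun v => g 0 v) 0]

/-- `(u, v) ↦ (Du Δu + a₁₁u + a₁₂v, Dv Δv + a₂₁u + a₂₂v)`, acting on the (complexified) space of
pairs in `H²(Ω)` satisfying the boundary condition, has the eigenvalue `β ∈ ℂ`. -/
def IsLinearizationEigenvalue {n : ℕ} (Ω : Set (E n)) (bc : BoundaryCondition)
    (A : Matrix (Fin 2) (Fin 2) ℝ) (Du Dv : ℝ) (β : ℂ) : Prop :=
  ∃ u v wu wv : E n → ℂ, HasLaplacian Ω bc u wu ∧ HasLaplacian Ω bc v wv ∧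
    ¬ (u =ᵐ[volume.restrict Ω] 0 ∧ v =ᵐ[volume.restrict Ω] 0) ∧
    ∀ᵐ x ∂(volume.restrict Ω),
      (Du : ℂ) * wu x + (A 0 0 : ℂ) * u x + (A 0 1 : ℂ) * v x = β * u x ∧
      (Dv : ℂ) * wv x + (A 1 0 : ℂ) * u x + (A 1 1 : ℂ) * v x = β * v x

/-- The steady state `(0,0)` is linearly stable for the kinetics `u' = f(u,v)`, `v' = g(u,v)`
without diffusion. -/
def IsKineticallyStable (f g : ℝ → ℝ → ℝ) : Prop :=
  ∀ z : ℂ, Module.End.HasEigenvalue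
    (Matrix.toLin' ((jacobian f g).map (algebraMap ℝ ℂ))) z → z.re < 0

/-- Turing (diffusion-driven) instability of the steady state `(0,0)` of
`u_t = Du Δu + f(u,v)`, `v_t = Dv Δv + g(u,v)` in `Ω`: it is stable without diffusion, while the
linearization with diffusion has an eigenvalue with positive real part. -/
def IsTuringUnstable {n : ℕ} (Ω : Set (E n)) (bc : BoundaryCondition)
    (f g : ℝ → ℝ → ℝ) (Du Dv : ℝ) : Prop :=
  IsKineticallyStable f g ∧
    ∃ β : ℂ, IsLinearizationEigenvalue Ω bc (jacobian f g) Du Dv β ∧ 0 < β.re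

/-- The matrix `M_lam` of the linearization on the eigenspace of `-Δ` for `lam`. -/
def modeMatrix (A : Matrix (Fin 2) (Fin 2) ℝ) (Du Dv lam : ℝ) : Matrix (Fin 2) (Fin 2) ℝ :=
  !![A 0 0 - lam * Du, A 0 1; A 1 0, A 1 1 - lam * Dv]

/-- The polynomial `h(lam) = Du Dv lam² - (a₁₁ Dv + a₂₂ Du) lam + det A`. -/
def hPoly (A : Matrix (Fin 2) (Fin 2) ℝ) (Du Dv lam : ℝ) : ℝ :=
  Du * Dv * lam ^ 2 - (A 0 0 * Dv + A 1 1 * Du) * lam + A.det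

/-- `q = 4 Du det A - 2 a₁₁ a₂₂ Du`. -/
def qCoeff (A : Matrix (Fin 2) (Fin 2) ℝ) (Du : ℝ) : ℝ :=
  4 * Du * A.det - 2 * A 0 0 * A 1 1 * Du

/-- `D_v⁰`, the larger root of `a₁₁² d² - q d + a₂₂² Du² = 0`; for this diffusion coefficient the
minimum of `h` over `ℝ` is zero. -/
def Dv0 (A : Matrix (Fin 2) (Fin 2) ℝ) (Du : ℝ) : ℝ :=
  (qCoeff A Du + Real.sqrt (qCoeff A Du ^ 2 - 4 * A 0 0 ^ 2 * A 1 1 ^ 2 * Du ^ 2)) /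
    (2 * A 0 0 ^ 2)

/-- `k_c⁰`, the point where `h` is minimal when `D_v = D_v⁰`. -/
def kc0 (A : Matrix (Fin 2) (Fin 2) ℝ) (Du : ℝ) : ℝ :=
  (A 0 0 * Dv0 A Du + A 1 1 * Du) / (2 * Du * Dv0 A Du)

/-- `D_v^lam`: the positive number `d` with `h(lam) = 0` for `D_v = d` (the equation is affine in
`d`); it is `+∞` if there is no such positive `d`. -/
def DvRoot (A : Matrix (Fin 2) (Fin 2) ℝ) (Du lam : ℝ) : EReal :=
  sInf ((fun d : ℝ => (d : EReal)) '' {d : ℝ | 0 < d ∧ hPoly A Du d lam = 0})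

/-- `D_v^* = min {D_v^lam, D_v^lam'}`. -/
def DvStar (A : Matrix (Fin 2) (Fin 2) ℝ) (Du lam lam' : ℝ) : EReal :=
  min (DvRoot A Du lam) (DvRoot A Du lam')

end

end TuringRD

/-! On an eigenfunction of `-Δ` with eigenvalue `λ` the linearization acts as the matrix `M_λ`, with
characteristic polynomial `β² - (Tr A - λ(Du + Dv))β + h(λ)`. Since `λ ≥ 0`, its trace is negative,
so a root with positive real part exists exactly when `h(λ) < 0`; hence instability means `h < 0` at
some Laplace eigenvalue (`isTuringUnstable_iff`). No completeness of eigenfunctions is needed: an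
eigenpair `(u, v)` spans a finite-dimensional `Δ`-invariant space, which contains an eigenfunction
(`exists_scalar_eigenfunction`).

For fixed `λ ≥ 0`, `h(λ)` is affine in `Dv` with positive intercept, so it is negative exactly
beyond its positive root (`dvRoot_lt_iff`). At `Dv0` the parabola `h` touches zero at `kc0`. If
`h(μ) < 0` for some `Dv`, then `Dv > Dv0`, so `h(kc0) < 0`, and convexity makes `h` negative between
`μ` and `kc0` (`hPoly_neg_of_between`). Some eigenvalue adjacent to `kc0` lies there, so only those
two matter. -/

namespace TuringRD

/-! ### Linearity, conjugation and Green's formula for the weak Laplacian. -/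

section Sobolev

variable {n : ℕ} {Ω : Set (E n)}

lemma IsTestFunction.lincomb {φ ψ : E n → ℂ} (hφ : IsTestFunction Ω φ) (hψ : IsTestFunction Ω ψ)
    (a b : ℂ) : IsTestFunction Ω (fun x => a * φ x + b * ψ x) := by
  have hsupp : tsupport (fun x => a * φ x + b * ψ x) ⊆ tsupport φ ∪ tsupport ψ := by
    refine closure_minimal ?_ ((isClosed_tsupport _).union (isClosed_tsupport _))
    intro x hx
    by_contra hcon
    simp only [Set.mem_union, not_or] at hcon
    exact hx (by simp [image_eq_zero_of_notMem_tsupport hcon.1,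
      image_eq_zero_of_notMem_tsupport hcon.2])
  refine ⟨(contDiff_const.mul hφ.1).add (contDiff_const.mul hψ.1), ?_,
    hsupp.trans (Set.union_subset hφ.2.2 hψ.2.2)⟩
  exact (hφ.2.1.union hψ.2.1).of_isClosed_subset (isClosed_tsupport _) hsupp

lemma partialDeriv_lincomb {φ ψ : E n → ℂ} (hφ : Differentiable ℝ φ) (hψ : Differentiable ℝ ψ)
    (a b : ℂ) (i : Fin n) (x : E n) :
    partialDeriv i (fun x => a * φ x + b * ψ x) x =
      a * partialDeriv i φ x + b * partialDeriv i ψ x := by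
  have h := ((hφ x).hasFDerivAt.const_mul a).add ((hψ x).hasFDerivAt.const_mul b)
  unfold partialDeriv
  rw [HasFDerivAt.fderiv (f := fun x => a * φ x + b * ψ x) h]
  simp

/-- The pairings in the weak definitions are bilinear, so `L²` norms appear only after testing with
conjugates. -/
lemma IsTestFunction.star {φ : E n → ℂ} (hφ : IsTestFunction Ω φ) :
    IsTestFunction Ω (fun x => star (φ x)) := by
  have hsupp : tsupport (fun x => Star.star (φ x)) = tsupport φ := by
    unfold tsupport
    congr 1
    ext x
    simp
  refine ⟨Complex.conjCLE.contDiff.comp hφ.1, ?_, hsupp ▸ hφ.2.2⟩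
  unfold HasCompactSupport
  rw [hsupp]
  exact hφ.2.1

lemma partialDeriv_star {φ : E n → ℂ} (hφ : Differentiable ℝ φ) (i : Fin n) (x : E n) :
    partialDeriv i (fun x => star (φ x)) x = star (partialDeriv i φ x) := by
  have h := (Complex.conjCLE.toContinuousLinearMap.hasFDerivAt (x := φ x)).comp x
    (hφ x).hasFDerivAt
  unfold partialDeriv
  rw [HasFDerivAt.fderiv (f := fun x => star (φ x)) h]
  simp

lemma IsTestFunction.differentiable {φ : E n → ℂ} (hφ : IsTestFunction Ω φ) :
    Differentiable ℝ φ :=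
  hφ.1.differentiable (by simp)

lemma IsTestFunction.memLp {φ : E n → ℂ} (hφ : IsTestFunction Ω φ) :
    MemLp φ 2 (volume.restrict Ω) :=
  hφ.1.continuous.memLp_of_hasCompactSupport hφ.2.1

lemma IsTestFunction.memLp_partialDeriv {φ : E n → ℂ} (hφ : IsTestFunction Ω φ) (i : Fin n) :
    MemLp (partialDeriv i φ) 2 (volume.restrict Ω) := by
  refine Continuous.memLp_of_hasCompactSupport ?_ (hφ.2.1.fderiv_apply ℝ _)
  exact (hφ.1.continuous_fderiv (by simp)).clm_apply continuous_const

lemma MemLp.lincomb {u v : E n → ℂ} (hu : MemLp u 2 (volume.restrict Ω))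
    (hv : MemLp v 2 (volume.restrict Ω)) (a b : ℂ) :
    MemLp (fun x => a * u x + b * v x) 2 (volume.restrict Ω) :=
  (hu.const_mul a).add (hv.const_mul b)

lemma integrable_mul_of_memLp {f g : E n → ℂ} (hf : MemLp f 2 (volume.restrict Ω))
    (hg : MemLp g 2 (volume.restrict Ω)) :
    Integrable (fun x => f x * g x) (volume.restrict Ω) :=
  hf.integrable_mul hg

lemma integrable_mul_star_of_memLp {f g : E n → ℂ} (hf : MemLp f 2 (volume.restrict Ω))
    (hg : MemLp g 2 (volume.restrict Ω)) :
    Integrable (fun x => f x * star (g x)) (volume.restrict Ω) :=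
  hf.integrable_mul hg.star

lemma HasWeakPartial.lincomb {i : Fin n} {u v g k : E n → ℂ}
    (hu : MemLp u 2 (volume.restrict Ω)) (hv : MemLp v 2 (volume.restrict Ω))
    (hg : MemLp g 2 (volume.restrict Ω)) (hk : MemLp k 2 (volume.restrict Ω))
    (hug : HasWeakPartial Ω i u g) (hvk : HasWeakPartial Ω i v k) (a b : ℂ) :
    HasWeakPartial Ω i (fun x => a * u x + b * v x) (fun x => a * g x + b * k x) := by
  intro φ hφ
  have key : ∀ {p q r : E n → ℂ}, MemLp p 2 (volume.restrict Ω) →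
      MemLp q 2 (volume.restrict Ω) → MemLp r 2 (volume.restrict Ω) →
      ∫ x in Ω, (a * p x + b * q x) * r x =
        a * (∫ x in Ω, p x * r x) + b * ∫ x in Ω, q x * r x := by
    intro p q r hp hq hr
    rw [← integral_const_mul, ← integral_const_mul, ← integral_add
      ((integrable_mul_of_memLp hp hr).const_mul a) ((integrable_mul_of_memLp hq hr).const_mul b)]
    exact integral_congr_ae (.of_forall fun x => by simp only; ring)
  rw [key hu hv (hφ.memLp_partialDeriv i), key hg hk hφ.memLp, hug φ hφ, hvk φ hφ]
  ring

lemma HasWeakPartial.star {i : Fin n} {u g : E n → ℂ} (h : HasWeakPartial Ω i u g) :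
    HasWeakPartial Ω i (fun x => star (u x)) (fun x => star (g x)) := by
  intro φ hφ
  have h1 := congrArg (starRingEnd ℂ) (h _ hφ.star)
  rw [map_neg, ← integral_conj, ← integral_conj] at h1
  simp only [partialDeriv_star hφ.differentiable, map_mul] at h1
  simpa using h1

lemma HasH1Gradient.lincomb {u v : E n → ℂ} {G H : Fin n → E n → ℂ}
    (hu : HasH1Gradient Ω u G) (hv : HasH1Gradient Ω v H) (a b : ℂ) :
    HasH1Gradient Ω (fun x => a * u x + b * v x) (fun i x => a * G i x + b * H i x) :=
  ⟨MemLp.lincomb hu.1 hv.1 a b, fun i => ⟨MemLp.lincomb (hu.2 i).1 (hv.2 i).1 a b,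
    HasWeakPartial.lincomb hu.1 hv.1 (hu.2 i).1 (hv.2 i).1 (hu.2 i).2 (hv.2 i).2 a b⟩⟩

lemma HasH1Gradient.star {u : E n → ℂ} {G : Fin n → E n → ℂ} (hu : HasH1Gradient Ω u G) :
    HasH1Gradient Ω (fun x => star (u x)) (fun i x => star (G i x)) :=
  ⟨hu.1.star, fun i => ⟨(hu.2 i).1.star, (hu.2 i).2.star⟩⟩

lemma tendsto_eLpNorm_lincomb {p q : ℕ → E n → ℂ} {u v : E n → ℂ}
    (hp : ∀ k, MemLp (p k) 2 (volume.restrict Ω)) (hq : ∀ k, MemLp (q k) 2 (volume.restrict Ω))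
    (hu : MemLp u 2 (volume.restrict Ω)) (hv : MemLp v 2 (volume.restrict Ω))
    (hpu : Tendsto (fun k => eLpNorm (fun x => p k x - u x) 2 (volume.restrict Ω)) atTop (𝓝 0))
    (hqv : Tendsto (fun k => eLpNorm (fun x => q k x - v x) 2 (volume.restrict Ω)) atTop (𝓝 0))
    (a b : ℂ) :
    Tendsto (fun k => eLpNorm (fun x => (a * p k x + b * q k x) - (a * u x + b * v x)) 2
      (volume.restrict Ω)) atTop (𝓝 0) := by
  have hlim : Tendsto (fun k => ‖a‖ₑ * eLpNorm (fun x => p k x - u x) 2 (volume.restrict Ω) +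
      ‖b‖ₑ * eLpNorm (fun x => q k x - v x) 2 (volume.restrict Ω)) atTop (𝓝 0) := by
    have h := (ENNReal.Tendsto.const_mul (a := ‖a‖ₑ) hpu (Or.inr enorm_ne_top)).add
      (ENNReal.Tendsto.const_mul (a := ‖b‖ₑ) hqv (Or.inr enorm_ne_top))
    simpa using h
  refine tendsto_of_tendsto_of_tendsto_of_le_of_le tendsto_const_nhds hlim
    (fun _ => zero_le) fun k => ?_
  have h := eLpNorm_add_le (p := 2) (((hp k).sub hu).const_mul a).aestronglyMeasurable
    (((hq k).sub hv).const_mul b).aestronglyMeasurable (by norm_num)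
  have h1 := eLpNorm_const_smul_le (c := a) (f := fun x => p k x - u x) (p := 2)
    (μ := volume.restrict Ω)
  have h2 := eLpNorm_const_smul_le (c := b) (f := fun x => q k x - v x) (p := 2)
    (μ := volume.restrict Ω)
  refine le_trans (le_of_eq ?_) (h.trans (add_le_add h1 h2))
  congr 1
  funext x
  simp only [Pi.add_apply, Pi.sub_apply]
  ring

lemma VanishesOnBoundary.lincomb {u v : E n → ℂ} {G H : Fin n → E n → ℂ}
    (hu : HasH1Gradient Ω u G) (hv : HasH1Gradient Ω v H)
    (hu0 : VanishesOnBoundary Ω u G) (hv0 : VanishesOnBoundary Ω v H) (a b : ℂ) :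
    VanishesOnBoundary Ω (fun x => a * u x + b * v x) (fun i x => a * G i x + b * H i x) := by
  obtain ⟨φ, hφ, hφu, hφG⟩ := hu0
  obtain ⟨ψ, hψ, hψv, hψH⟩ := hv0
  refine ⟨fun k x => a * φ k x + b * ψ k x, fun k => (hφ k).lincomb (hψ k) a b,
    tendsto_eLpNorm_lincomb (fun k => (hφ k).memLp) (fun k => (hψ k).memLp) hu.1 hv.1 hφu hψv a b,
    fun i => ?_⟩
  simp only [partialDeriv_lincomb (hφ _).differentiable (hψ _).differentiable]
  exact tendsto_eLpNorm_lincomb (fun k => (hφ k).memLp_partialDeriv i)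
    (fun k => (hψ k).memLp_partialDeriv i) (hu.2 i).1 (hv.2 i).1 (hφG i) (hψH i) a b

lemma integrable_green {G Ψ : Fin n → E n → ℂ} {w ψ : E n → ℂ}
    (hG : ∀ i, MemLp (G i) 2 (volume.restrict Ω)) (hΨ : ∀ i, MemLp (Ψ i) 2 (volume.restrict Ω))
    (hw : MemLp w 2 (volume.restrict Ω)) (hψ : MemLp ψ 2 (volume.restrict Ω)) :
    Integrable (fun x => (∑ i, G i x * Ψ i x) + w x * ψ x) (volume.restrict Ω) :=
  (integrable_finsetSum _ fun i _ => (hG i).integrable_mul (hΨ i)).add (hw.integrable_mul hψ)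

lemma NormalDerivVanishes.lincomb {G H : Fin n → E n → ℂ} {w z : E n → ℂ}
    (hG : ∀ i, MemLp (G i) 2 (volume.restrict Ω)) (hH : ∀ i, MemLp (H i) 2 (volume.restrict Ω))
    (hw : MemLp w 2 (volume.restrict Ω)) (hz : MemLp z 2 (volume.restrict Ω))
    (h1 : NormalDerivVanishes Ω G w) (h2 : NormalDerivVanishes Ω H z) (a b : ℂ) :
    NormalDerivVanishes Ω (fun i x => a * G i x + b * H i x) (fun x => a * w x + b * z x) := by
  intro ψ Ψ hψ
  have hΨ := fun i => (hψ.2 i).1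
  have key : ∫ x in Ω, ((∑ i, (a * G i x + b * H i x) * Ψ i x) + (a * w x + b * z x) * ψ x) =
      a * (∫ x in Ω, ((∑ i, G i x * Ψ i x) + w x * ψ x)) +
        b * ∫ x in Ω, ((∑ i, H i x * Ψ i x) + z x * ψ x) := by
    rw [← integral_const_mul, ← integral_const_mul, ← integral_add
      ((integrable_green hG hΨ hw hψ.1).const_mul a)
      ((integrable_green hH hΨ hz hψ.1).const_mul b)]
    refine integral_congr_ae (.of_forall fun x => ?_)
    simp only [add_mul, Finset.sum_add_distrib, mul_add, Finset.mul_sum, mul_assoc]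
    ring
  rw [key, h1 ψ Ψ hψ, h2 ψ Ψ hψ]
  simp

lemma memLp_of_ae_eq_trace {K : Fin n → Fin n → E n → ℂ} {G : Fin n → E n → ℂ} {w : E n → ℂ}
    (hK : ∀ i, HasH1Gradient Ω (G i) (K i))
    (hw : w =ᵐ[volume.restrict Ω] (fun x => ∑ i, K i i x)) : MemLp w 2 (volume.restrict Ω) :=
  (memLp_congr_ae hw).2 (memLp_finsetSum _ fun i _ => ((hK i).2 i).1)

lemma HasLaplacian.lincomb {bc : BoundaryCondition} {u v w z : E n → ℂ}
    (hu : HasLaplacian Ω bc u w) (hv : HasLaplacian Ω bc v z) (a b : ℂ) :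
    HasLaplacian Ω bc (fun x => a * u x + b * v x) (fun x => a * w x + b * z x) := by
  obtain ⟨G, K, hG, hK, hw, hbc⟩ := hu
  obtain ⟨H, J, hH, hJ, hz, hbc'⟩ := hv
  refine ⟨_, _, hG.lincomb hH a b, fun i => (hK i).lincomb (hJ i) a b, ?_, ?_⟩
  · filter_upwards [hw, hz] with x hx hx'
    simp only [hx, hx', Finset.sum_add_distrib, Finset.mul_sum]
  · cases bc with
    | dirichlet => exact VanishesOnBoundary.lincomb hG hH hbc hbc' a b
    | neumann =>
      exact NormalDerivVanishes.lincomb (fun i => (hG.2 i).1) (fun i => (hH.2 i).1)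
        (memLp_of_ae_eq_trace hK hw) (memLp_of_ae_eq_trace hJ hz) hbc hbc' a b

/-- Hölder's inequality turns `L²` convergence into `L¹` convergence of the products. This carries
Green's formula from test functions to their `H¹₀` limit. -/
lemma tendsto_integral_mul_star {f g : E n → ℂ} {p : ℕ → E n → ℂ}
    (hf : MemLp f 2 (volume.restrict Ω)) (hg : MemLp g 2 (volume.restrict Ω))
    (hp : ∀ k, MemLp (p k) 2 (volume.restrict Ω))
    (hpg : Tendsto (fun k => eLpNorm (fun x => p k x - g x) 2 (volume.restrict Ω)) atTop (𝓝 0)) :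
    Tendsto (fun k => ∫ x in Ω, f x * star (p k x)) atTop (𝓝 (∫ x in Ω, f x * star (g x))) := by
  refine tendsto_integral_of_L1' _ (integrable_mul_star_of_memLp hf hg).aestronglyMeasurable
    (.of_forall fun k => integrable_mul_star_of_memLp hf (hp k)) ?_
  have hlim : Tendsto (fun k => eLpNorm f 2 (volume.restrict Ω) *
      eLpNorm (fun x => p k x - g x) 2 (volume.restrict Ω)) atTop (𝓝 0) := by
    simpa using ENNReal.Tendsto.const_mul (a := eLpNorm f 2 (volume.restrict Ω)) hpg
      (Or.inr hf.eLpNorm_ne_top)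
  refine tendsto_of_tendsto_of_tendsto_of_le_of_le tendsto_const_nhds hlim
    (fun _ => zero_le) fun k => ?_
  have h := eLpNorm_smul_le_mul_eLpNorm (p := 2) (q := 2) (r := 1)
    ((hp k).sub hg).star.aestronglyMeasurable hf.aestronglyMeasurable
  rw [eLpNorm_star] at h
  refine le_trans (le_of_eq ?_) h
  congr 1
  funext x
  simp [mul_sub]

/-- Green's formula for a function satisfying the boundary condition, tested with its own complex
conjugate. -/
lemma green_self {bc : BoundaryCondition} {u w : E n → ℂ} (h : HasLaplacian Ω bc u w) :
    ∃ G : Fin n → E n → ℂ, HasH1Gradient Ω u G ∧ MemLp w 2 (volume.restrict Ω) ∧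
      ∫ x in Ω, ((∑ i, G i x * star (G i x)) + w x * star (u x)) = 0 := by
  obtain ⟨G, K, hG, hK, hw, hbc⟩ := h
  have hwm := memLp_of_ae_eq_trace hK hw
  refine ⟨G, hG, hwm, ?_⟩
  cases bc with
  | neumann => exact hbc _ _ hG.star
  | dirichlet =>
    obtain ⟨φ, hφ, hφu, hφG⟩ := hbc
    have hsplit : ∀ {P : Fin n → E n → ℂ} {p : E n → ℂ},
        (∀ i, MemLp (P i) 2 (volume.restrict Ω)) → MemLp p 2 (volume.restrict Ω) →
        ∫ x in Ω, ((∑ i, G i x * star (P i x)) + w x * star (p x)) =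
          (∑ i, ∫ x in Ω, G i x * star (P i x)) + ∫ x in Ω, w x * star (p x) := by
      intro P p hP hp
      rw [← integral_finsetSum _ fun i _ => integrable_mul_star_of_memLp (hG.2 i).1 (hP i)]
      exact integral_add (integrable_finsetSum _ fun i _ =>
        integrable_mul_star_of_memLp (hG.2 i).1 (hP i)) (integrable_mul_star_of_memLp hwm hp)
    -- Against a test function, Green's formula is the definition of the weak derivatives `K i i` of
    -- `G i`, summed over `i`.
    have hzero : ∀ k, (∑ i, ∫ x in Ω, G i x * star (partialDeriv i (φ k) x)) +
        ∫ x in Ω, w x * star (φ k x) = 0 := by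
      intro k
      have h1 : ∀ i, ∫ x in Ω, G i x * star (partialDeriv i (φ k) x) =
          - ∫ x in Ω, K i i x * star (φ k x) := by
        intro i
        have h2 := ((hK i).2 i).2 _ (hφ k).star
        simpa only [partialDeriv_star (hφ k).differentiable] using h2
      have h3 : ∫ x in Ω, w x * star (φ k x) = ∑ i, ∫ x in Ω, K i i x * star (φ k x) := by
        rw [← integral_finsetSum _ fun i _ =>
          integrable_mul_star_of_memLp ((hK i).2 i).1 (hφ k).memLp]
        refine integral_congr_ae ?_
        filter_upwards [hw] with x hx
        rw [hx, Finset.sum_mul]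
      rw [h3, Finset.sum_congr rfl fun i _ => h1 i, Finset.sum_neg_distrib, neg_add_cancel]
    have hlim := (tendsto_finsetSum Finset.univ fun i _ =>
      tendsto_integral_mul_star (hG.2 i).1 (hG.2 i).1
        (fun k => (hφ k).memLp_partialDeriv i) (hφG i)).add
      (tendsto_integral_mul_star hwm hG.1 (fun k => (hφ k).memLp) hφu)
    simp only [hzero] at hlim
    rw [hsplit (fun i => (hG.2 i).1) hG.1]
    exact (tendsto_nhds_unique tendsto_const_nhds hlim).symm

/-- The eigenvalues of `-Δ` under either boundary condition are real and nonnegative. -/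
lemma eigenvalue_eq_ofReal {bc : BoundaryCondition} {u w : E n → ℂ} {z : ℂ}
    (h : HasLaplacian Ω bc u w) (hu : ¬ (u =ᵐ[volume.restrict Ω] 0))
    (hz : ∀ᵐ x ∂(volume.restrict Ω), - w x = z * u x) :
    ∃ lam : ℝ, 0 ≤ lam ∧ z = (lam : ℂ) := by
  obtain ⟨G, hG, hw, hgreen⟩ := green_self h
  set S : ℝ := ∫ x in Ω, ∑ i, ‖G i x‖ ^ 2 with hS
  set N : ℝ := ∫ x in Ω, ‖u x‖ ^ 2 with hN
  have hS0 : 0 ≤ S := integral_nonneg fun x => Finset.sum_nonneg fun i _ => sq_nonneg _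
  have hNpos : 0 < N := by
    have hN0 : 0 ≤ N := integral_nonneg fun x => sq_nonneg _
    refine lt_of_le_of_ne hN0 fun h0 => hu ?_
    have h1 := (integral_eq_zero_iff_of_nonneg (fun x => sq_nonneg ‖u x‖)
      hG.1.norm.integrable_sq).1 h0.symm
    filter_upwards [h1] with x hx
    simpa using hx
  have hself : ∀ c : ℂ, c * star c = ((‖c‖ ^ 2 : ℝ) : ℂ) := by
    intro c
    simpa using Complex.mul_conj' c
  have hsum : Integrable (fun x => ∑ i, G i x * star (G i x)) (volume.restrict Ω) :=
    integrable_finsetSum _ fun i _ => integrable_mul_star_of_memLp (hG.2 i).1 (hG.2 i).1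
  have h2 : ∫ x in Ω, w x * star (u x) = -(z * (N : ℂ)) := by
    rw [hN, ← integral_complex_ofReal, ← integral_const_mul, ← integral_neg]
    refine integral_congr_ae ?_
    filter_upwards [hz] with x hx
    rw [← hself, ← mul_assoc, ← hx]
    ring
  have h3 : ∫ x in Ω, ∑ i, G i x * star (G i x) = (S : ℂ) := by
    rw [hS, ← integral_complex_ofReal]
    refine integral_congr_ae (.of_forall fun x => ?_)
    simp only [hself, Complex.ofReal_sum]
  rw [integral_add hsum (integrable_mul_star_of_memLp hw hG.1), h2, h3] at hgreen
  -- Green's formula now reads `S = z N`, so `z` is the Rayleigh quotient.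
  refine ⟨S / N, div_nonneg hS0 hNpos.le, ?_⟩
  have hNc : (N : ℂ) ≠ 0 := Complex.ofReal_ne_zero.2 hNpos.ne'
  rw [Complex.ofReal_div, eq_div_iff hNc]
  linear_combination -hgreen

end Sobolev

/-! ### The polynomial `h` as a function of `λ` and of `Dv`. -/

section Algebra

variable {A : Matrix (Fin 2) (Fin 2) ℝ} {Du : ℝ}

/-- The roots of `z² - T z + h` with `T < 0` have nonpositive real part if `0 ≤ h`, and negative
real part if `0 < h`. -/
lemma re_of_quadratic {T h : ℝ} {z : ℂ} (hT : T < 0) (hz : z ^ 2 - T * z + h = 0) :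
    (0 ≤ h → z.re ≤ 0) ∧ (0 < h → z.re < 0) := by
  have hre := congrArg Complex.re hz
  have him := congrArg Complex.im hz
  simp [pow_two] at hre him
  -- The imaginary part of the equation is `Im z (2 Re z - T) = 0`, and `T < 0`.
  have hreal : 0 ≤ z.re → z.im = 0 := by
    intro h0
    have h1 : z.im * (2 * z.re - T) = 0 := by linarith
    rcases mul_eq_zero.1 h1 with h2 | h2
    · exact h2
    · linarith
  constructor
  · intro hh
    by_contra! hcon
    rw [hreal hcon.le] at hre
    nlinarith [mul_pos hcon hcon, mul_pos hcon (neg_pos.2 hT)]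
  · intro hh
    by_contra! hcon
    rw [hreal hcon] at hre
    nlinarith [mul_nonneg hcon hcon, mul_nonneg hcon (neg_pos.2 hT).le]

/-- If the spectral gap below `k_c⁰` contains a nonnegative number, then `u` is an activator, `v` an
inhibitor, and `h` at `D_v = D_v⁰` has the double root `k_c⁰ ∈ (0, a₁₁ / D_u)`. -/
lemma critical_facts (hdet : 0 < A.det) (htr : A.trace < 0) (hDu : 0 < Du) (hDv0 : 0 < Dv0 A Du)
    (hk : 0 < kc0 A Du) :
    A 1 1 < 0 ∧ Du * kc0 A Du < A 0 0 ∧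
      ∀ μ, hPoly A Du (Dv0 A Du) μ = Du * Dv0 A Du * (μ - kc0 A Du) ^ 2 := by
  have htr' : A 0 0 + A 1 1 < 0 := by simpa [Matrix.trace_fin_two] using htr
  have hd := hDv0
  have hkdef : kc0 A Du * (2 * Du * Dv0 A Du) = A 0 0 * Dv0 A Du + A 1 1 * Du := by
    unfold kc0
    field_simp
  -- For `a₁₁ = 0` division by zero gives `Dv0 = 0`, contradicting positivity.
  have ha : A 0 0 ≠ 0 := by
    intro h0
    simp [Dv0, h0] at hDv0
  have hroot : Dv0 A Du * (2 * A 0 0 ^ 2) = qCoeff A Du +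
      Real.sqrt (qCoeff A Du ^ 2 - 4 * A 0 0 ^ 2 * A 1 1 ^ 2 * Du ^ 2) := by
    unfold Dv0
    field_simp
  have hq : qCoeff A Du = 4 * Du * A.det - 2 * A 0 0 * A 1 1 * Du := rfl
  simp only [hPoly]
  generalize Dv0 A Du = d at *
  generalize kc0 A Du = k at *
  generalize qCoeff A Du = q at *
  generalize A.det = D at *
  generalize A 0 0 = a at *
  generalize A 1 1 = b at *
  have hpos : 0 < a * d + b * Du := by rw [← hkdef]; positivity
  -- `Real.sqrt` is zero on negatives, so the discriminant needs a sign. If `a b ≤ 0`, then `q ≥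
  -- -2abDu ≥ 0`. If `a b > 0`, two negative entries contradict `hpos` and two positive ones the
  -- trace.
  have hdisc : 0 ≤ q ^ 2 - 4 * a ^ 2 * b ^ 2 * Du ^ 2 := by
    rcases le_or_gt (a * b) 0 with hab | hab
    · have h1 : -(2 * (a * b)) * Du ≤ q := by rw [hq]; nlinarith [mul_pos hDu hdet]
      have h2 : 0 ≤ -(2 * (a * b)) * Du := by nlinarith
      nlinarith [mul_self_le_mul_self h2 h1]
    · exfalso
      rcases lt_or_gt_of_ne ha with h | h
      · have hb : b < 0 := by nlinarith
        nlinarith [mul_neg_of_neg_of_pos h hd, mul_neg_of_neg_of_pos hb hDu]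
      · have hb : 0 < b := by nlinarith
        linarith
  have hs0 := Real.sqrt_nonneg (q ^ 2 - 4 * a ^ 2 * b ^ 2 * Du ^ 2)
  have hs := Real.sq_sqrt hdisc
  generalize Real.sqrt (q ^ 2 - 4 * a ^ 2 * b ^ 2 * Du ^ 2) = s at *
  have hquad : a ^ 2 * d ^ 2 - q * d + b ^ 2 * Du ^ 2 = 0 := by
    have hs' : s = d * (2 * a ^ 2) - q := by linarith
    rw [hs'] at hs
    have : 4 * a ^ 2 * (a ^ 2 * d ^ 2 - q * d + b ^ 2 * Du ^ 2) = 0 := by linarith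
    simpa [ha] using this
  -- As the larger root, `d` satisfies `q ≤ 2a²d`, whence `b²Du² ≤ a²d²`. For `a < 0` this
  -- contradicts `bDu > -ad > 0`.
  have ha0 : 0 < a := by
    refine lt_of_le_of_ne (not_lt.1 fun h => ?_) ha.symm
    have h1 : q ≤ d * (2 * a ^ 2) := by linarith
    have h2 : q * d ≤ 2 * a ^ 2 * d ^ 2 := by nlinarith
    have h3 : 0 < -(a * d) := by nlinarith
    nlinarith
  have hb0 : b < 0 := by linarith
  refine ⟨hb0, ?_, fun μ => ?_⟩
  · have h1 : d * (2 * (Du * k)) < d * a := by nlinarith [mul_neg_of_neg_of_pos hb0 hDu]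
    have h2 := lt_of_mul_lt_mul_left h1 hd.le
    have h3 := mul_pos hDu hk
    linarith
  · have h1 : Du * d * k ^ 2 = D := by
      -- The quadratic for `d` says `(ad + bDu)² = 4 Du d D`: the discriminant of `h` vanishes.
      have h2 : 4 * Du * d * (Du * d * k ^ 2 - D) = 0 := by
        linear_combination (k * (2 * Du * d) + (a * d + b * Du)) * hkdef + hquad + d * hq
      have h3 : 4 * Du * d ≠ 0 := by positivity
      linarith [(mul_eq_zero.1 h2).resolve_left h3]
    linear_combination μ * hkdef - h1

lemma hPoly_eq_affine (A : Matrix (Fin 2) (Fin 2) ℝ) (Du d μ : ℝ) :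
    hPoly A Du d μ = d * (μ * (Du * μ - A 0 0)) + (A.det - A 1 1 * Du * μ) := by
  unfold hPoly
  ring

/-- The affine function of `d` has intercept `c > 0`. With slope `m < 0` its only zero is `c / -m`;
with `m ≥ 0` there is no positive zero, and the infimum of the empty set is `⊤`. -/
lemma dvRoot_lt_iff (hdet : 0 < A.det) (hDu : 0 < Du) (hb : A 1 1 < 0) {μ d : ℝ} (hμ : 0 ≤ μ)
    (hd : 0 < d) : DvRoot A Du μ < (d : EReal) ↔ hPoly A Du d μ < 0 := by
  have hc : 0 < A.det - A 1 1 * Du * μ := by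
    nlinarith [mul_nonneg (mul_pos (neg_pos.2 hb) hDu).le hμ]
  unfold DvRoot
  simp only [sInf_lt_iff, Set.exists_mem_image, Set.mem_ofPred_eq, EReal.coe_lt_coe_iff,
    hPoly_eq_affine]
  generalize A.det - A 1 1 * Du * μ = c at *
  generalize μ * (Du * μ - A 0 0) = m at *
  constructor
  · rintro ⟨r, ⟨hr, hrm⟩, hrd⟩
    have hm : m < 0 := by nlinarith
    nlinarith
  · intro h
    have hm : m < 0 := by nlinarith
    refine ⟨c / -m, ⟨div_pos hc (neg_pos.2 hm), ?_⟩, ?_⟩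
    · rw [div_neg, neg_mul, div_mul_cancel₀ _ hm.ne, neg_add_cancel]
    · rw [div_lt_iff₀ (neg_pos.2 hm)]
      linarith

/-- If `h` is negative at some nonnegative `μ`, then it is negative at every point between `μ` and
`k_c⁰`. -/
lemma hPoly_neg_of_between (hdet : 0 < A.det) (htr : A.trace < 0) (hDu : 0 < Du)
    (hDv0 : 0 < Dv0 A Du) (hk : 0 < kc0 A Du) {d μ ν : ℝ} (hd : 0 < d) (hμ : 0 ≤ μ)
    (hneg : hPoly A Du d μ < 0)
    (hν : (μ ≤ ν ∧ ν < kc0 A Du) ∨ (kc0 A Du < ν ∧ ν ≤ μ)) : hPoly A Du d ν < 0 := by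
  obtain ⟨hb, hka, hsq⟩ := critical_facts hdet htr hDu hDv0 hk
  have hc : 0 < A.det - A 1 1 * Du * μ := by
    nlinarith [mul_nonneg (mul_pos (neg_pos.2 hb) hDu).le hμ]
  have hμ0 : 0 ≤ hPoly A Du (Dv0 A Du) μ := by rw [hsq]; positivity
  have hk0 : hPoly A Du (Dv0 A Du) (kc0 A Du) = 0 := by rw [hsq]; simp
  have hkneg : hPoly A Du d (kc0 A Du) < 0 := by
    have hneg' := hneg
    rw [hPoly_eq_affine] at hneg' hμ0 hk0 ⊢
    have hm : μ * (Du * μ - A 0 0) < 0 := by nlinarith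
    -- With slope `m < 0` in the diffusion coefficient, `h(μ)` is nonnegative at `Dv0` and negative
    -- at `d`. The slope at `kc0` is negative too, so `h(kc0)` drops below its value `0` at `Dv0`.
    have hdd : Dv0 A Du < d := by
      by_contra! h
      nlinarith [mul_nonneg (sub_nonneg.2 h) (neg_pos.2 hm).le]
    have hkm : kc0 A Du * (Du * kc0 A Du - A 0 0) < 0 :=
      mul_neg_of_pos_of_neg hk (by linarith)
    nlinarith [mul_pos (sub_pos.2 hdd) (neg_pos.2 hkm)]
  -- Convexity as an exact identity: chord interpolation with a correction by the leading
  -- coefficient `Du * d`.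
  have key : ∀ k : ℝ, hPoly A Du d ν * (k - μ) = hPoly A Du d μ * (k - ν) +
      hPoly A Du d k * (ν - μ) - Du * d * ((ν - μ) * (k - ν) * (k - μ)) := by
    intro k
    unfold hPoly
    ring
  have hkey := key (kc0 A Du)
  have hDud := mul_pos hDu hd
  rcases hν with ⟨h1, h2⟩ | ⟨h1, h2⟩
  · have e1 := mul_neg_of_neg_of_pos hneg (sub_pos.2 h2)
    have e2 := mul_nonpos_of_nonpos_of_nonneg hkneg.le (sub_nonneg.2 h1)
    have e3 : 0 ≤ Du * d * ((ν - μ) * (kc0 A Du - ν) * (kc0 A Du - μ)) :=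
      mul_nonneg hDud.le (mul_nonneg (mul_nonneg (by linarith) (by linarith)) (by linarith))
    exact neg_of_mul_neg_left (b := kc0 A Du - μ) (by linarith) (by linarith)
  · have e1 := mul_neg_of_neg_of_pos hneg (sub_pos.2 h1)
    have e2 := mul_nonpos_of_nonpos_of_nonneg hkneg.le (sub_nonneg.2 h2)
    have e3 : 0 ≤ Du * d * ((μ - ν) * (ν - kc0 A Du) * (μ - kc0 A Du)) :=
      mul_nonneg hDud.le (mul_nonneg (mul_nonneg (by linarith) (by linarith)) (by linarith))
    refine neg_of_mul_neg_left (b := μ - kc0 A Du) ?_ (by linarith)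
    linarith

end Algebra

/-! ### Reduction of the linearization to Laplace modes. -/

section Spectrum

variable {n : ℕ} {Ω : Set (E n)} {bc : BoundaryCondition}

lemma IsLaplaceEigenvalue.nonneg {lam : ℝ} (h : IsLaplaceEigenvalue Ω bc lam) : 0 ≤ lam := by
  obtain ⟨e, w, hL, he, hw⟩ := h
  obtain ⟨r, hr, hlr⟩ := eigenvalue_eq_ofReal hL he hw
  rwa [Complex.ofReal_inj.1 hlr]

/-- A nonzero pair whose Laplacian is `B` times the pair yields an eigenfunction of the Laplacian
for some eigenvalue of the `2 × 2` matrix `B`. -/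
lemma exists_scalar_eigenfunction {u v wu wv : E n → ℂ} {b₁ b₂ b₃ b₄ : ℂ}
    (hu : HasLaplacian Ω bc u wu) (hv : HasLaplacian Ω bc v wv)
    (hne : ¬ (u =ᵐ[volume.restrict Ω] 0 ∧ v =ᵐ[volume.restrict Ω] 0))
    (hwu : ∀ᵐ x ∂(volume.restrict Ω), wu x = b₁ * u x + b₂ * v x)
    (hwv : ∀ᵐ x ∂(volume.restrict Ω), wv x = b₃ * u x + b₄ * v x) :
    ∃ (μ : ℂ) (e w : E n → ℂ), (b₁ - μ) * (b₄ - μ) = b₂ * b₃ ∧ HasLaplacian Ω bc e w ∧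
      ¬ (e =ᵐ[volume.restrict Ω] 0) ∧ ∀ᵐ x ∂(volume.restrict Ω), w x = μ * e x := by
  obtain ⟨s, hs⟩ := IsAlgClosed.exists_pow_nat_eq ((b₁ - b₄) ^ 2 + 4 * b₂ * b₃) two_pos
  obtain ⟨μ, ν, hsum, hprod⟩ : ∃ μ ν : ℂ, μ + ν = b₁ + b₄ ∧ μ * ν = b₁ * b₄ - b₂ * b₃ :=
    ⟨(b₁ + b₄ + s) / 2, (b₁ + b₄ - s) / 2, by ring, by linear_combination -hs / 4⟩
  have hμ : (b₁ - μ) * (b₄ - μ) = b₂ * b₃ := by linear_combination -hprod + μ * hsum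
  have hν : (b₁ - ν) * (b₄ - ν) = b₂ * b₃ := by linear_combination -hprod + ν * hsum
  -- By Cayley–Hamilton `(B - ν)(B - μ) = 0`, so a nonzero component of `(B - μ)(u, v)` is an
  -- eigenfunction for `ν`. If both components vanish, `u` or `v` is one for `μ`.
  by_cases h1 : (fun x => (b₁ - μ) * u x + b₂ * v x) =ᵐ[volume.restrict Ω] 0
  · by_cases h2 : (fun x => b₃ * u x + (b₄ - μ) * v x) =ᵐ[volume.restrict Ω] 0
    · by_cases hu0 : u =ᵐ[volume.restrict Ω] 0
      · refine ⟨μ, v, wv, hμ, hv, fun hv0 => hne ⟨hu0, hv0⟩, ?_⟩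
        filter_upwards [h2, hwv] with x hx hx'
        simp only [Pi.zero_apply] at hx
        linear_combination hx' + hx
      · refine ⟨μ, u, wu, hμ, hu, hu0, ?_⟩
        filter_upwards [h1, hwu] with x hx hx'
        simp only [Pi.zero_apply] at hx
        linear_combination hx' + hx
    · refine ⟨ν, _, _, hν, hu.lincomb hv b₃ (b₄ - μ), h2, ?_⟩
      filter_upwards [hwu, hwv] with x hx hx'
      rw [hx, hx']
      linear_combination v x * hprod - (b₃ * u x + b₄ * v x) * hsum
  · refine ⟨ν, _, _, hν, hu.lincomb hv (b₁ - μ) b₂, h1, ?_⟩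
    filter_upwards [hwu, hwv] with x hx hx'
    rw [hx, hx']
    linear_combination u x * hprod - (b₁ * u x + b₂ * v x) * hsum

/-- Every eigenvalue of the linearization is an eigenvalue of some mode matrix. -/
lemma exists_mode_of_linearizationEigenvalue {A : Matrix (Fin 2) (Fin 2) ℝ} {Du Dv : ℝ} {β : ℂ}
    (hDu : 0 < Du) (hDv : 0 < Dv) (h : IsLinearizationEigenvalue Ω bc A Du Dv β) :
    ∃ lam : ℝ, IsLaplaceEigenvalue Ω bc lam ∧
      β ^ 2 - ((A.trace - lam * (Du + Dv) : ℝ) : ℂ) * β + (hPoly A Du Dv lam : ℂ) = 0 := by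
  obtain ⟨u, v, wu, wv, hu, hv, hne, heq⟩ := h
  have hDu' : (Du : ℂ) ≠ 0 := Complex.ofReal_ne_zero.2 hDu.ne'
  have hDv' : (Dv : ℂ) ≠ 0 := Complex.ofReal_ne_zero.2 hDv.ne'
  obtain ⟨μ, e, w, hμ, hL, he, hw⟩ := exists_scalar_eigenfunction
    (b₁ := (β - A 0 0) / Du) (b₂ := -A 0 1 / Du) (b₃ := -A 1 0 / Dv) (b₄ := (β - A 1 1) / Dv)
    hu hv hne (by
      filter_upwards [heq] with x hx
      field_simp
      linear_combination hx.1) (by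
      filter_upwards [heq] with x hx
      field_simp
      linear_combination hx.2)
  have hw' : ∀ᵐ x ∂(volume.restrict Ω), - w x = (-μ) * e x := by
    filter_upwards [hw] with x hx
    rw [hx, neg_mul]
  obtain ⟨lam, -, hlam⟩ := eigenvalue_eq_ofReal hL he hw'
  refine ⟨lam, ⟨e, w, hL, he, by rwa [hlam] at hw'⟩, ?_⟩
  obtain rfl : μ = -(lam : ℂ) := by rw [← hlam, neg_neg]
  field_simp at hμ
  simp only [hPoly, Matrix.trace_fin_two, Matrix.det_fin_two]
  push_cast
  linear_combination hμ

/-- A real eigenvalue of the mode matrix of a Laplace eigenvalue is an eigenvalue of the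
linearization. -/
lemma linearizationEigenvalue_of_mode {A : Matrix (Fin 2) (Fin 2) ℝ} {Du Dv lam β : ℝ}
    (h : IsLaplaceEigenvalue Ω bc lam)
    (hβ : β ^ 2 - (A.trace - lam * (Du + Dv)) * β + hPoly A Du Dv lam = 0) :
    IsLinearizationEigenvalue Ω bc A Du Dv β := by
  obtain ⟨e, w, hL, he, hw⟩ := h
  have hdet : (modeMatrix A Du Dv lam - β • (1 : Matrix (Fin 2) (Fin 2) ℝ)).det = 0 := by
    rw [← hβ]
    simp [modeMatrix, hPoly, Matrix.det_fin_two, Matrix.trace_fin_two]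
    ring
  obtain ⟨c, hc, hMc⟩ := Matrix.exists_mulVec_eq_zero_iff.2 hdet
  have h0 := congrFun hMc 0
  have h1 := congrFun hMc 1
  simp [modeMatrix, Matrix.mulVec, dotProduct, Fin.sum_univ_two] at h0 h1
  have h0' := congrArg (algebraMap ℝ ℂ) h0
  have h1' := congrArg (algebraMap ℝ ℂ) h1
  simp at h0' h1'
  -- The eigenpair is `(c 0 · e, c 1 · e)`, with `c` in the kernel of `M_λ - β`; the zero
  -- coefficients reduce `lincomb` to scalar multiples.
  refine ⟨_, _, _, _, hL.lincomb hL (c 0) 0, hL.lincomb hL (c 1) 0, ?_, ?_⟩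
  · rintro ⟨hu, hv⟩
    refine hc (funext fun i => ?_)
    by_contra hi
    refine he ?_
    fin_cases i
    · filter_upwards [hu] with x hx
      simpa [show c 0 ≠ 0 from hi] using hx
    · filter_upwards [hv] with x hx
      simpa [show c 1 ≠ 0 from hi] using hx
  · filter_upwards [hw] with x hx
    constructor
    · linear_combination e x * h0' - Du * c 0 * hx
    · linear_combination e x * h1' - Dv * c 1 * hx

lemma isKineticallyStable_of_det_pos {f g : ℝ → ℝ → ℝ} (hdet : 0 < (jacobian f g).det)
    (htr : (jacobian f g).trace < 0) : IsKineticallyStable f g := by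
  intro z hz
  obtain ⟨c, hc⟩ := hz.exists_hasEigenvector
  have hdet0 : ((jacobian f g).map (algebraMap ℝ ℂ) - z • (1 : Matrix (Fin 2) (Fin 2) ℂ)).det =
      0 := by
    refine Matrix.exists_mulVec_eq_zero_iff.1 ⟨c, hc.2, ?_⟩
    have h := hc.apply_eq_smul
    rw [Matrix.toLin'_apply] at h
    rw [Matrix.sub_mulVec, h, Matrix.smul_mulVec, Matrix.one_mulVec, sub_self]
  refine (re_of_quadratic htr (h := (jacobian f g).det) ?_).2 hdet
  rw [← hdet0]
  simp only [Matrix.det_fin_two, Matrix.trace_fin_two]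
  simp
  ring

/-- Turing instability amounts to `h` being negative at some Laplace eigenvalue. -/
lemma isTuringUnstable_iff {f g : ℝ → ℝ → ℝ} {Du Dv : ℝ} (hdet : 0 < (jacobian f g).det)
    (htr : (jacobian f g).trace < 0) (hDu : 0 < Du) (hDv : 0 < Dv) :
    IsTuringUnstable Ω bc f g Du Dv ↔
      ∃ lam : ℝ, IsLaplaceEigenvalue Ω bc lam ∧ hPoly (jacobian f g) Du Dv lam < 0 := by
  have hT : ∀ lam : ℝ, 0 ≤ lam → (jacobian f g).trace - lam * (Du + Dv) < 0 := fun lam h =>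
    by nlinarith [mul_nonneg h (add_pos hDu hDv).le]
  constructor
  · rintro ⟨-, β, hβ, hre⟩
    obtain ⟨lam, hlam, hquad⟩ := exists_mode_of_linearizationEigenvalue hDu hDv hβ
    refine ⟨lam, hlam, ?_⟩
    by_contra! hh
    exact hre.not_ge ((re_of_quadratic (hT lam hlam.nonneg) hquad).1 hh)
  · rintro ⟨lam, hlam, hneg⟩
    have hT' := hT lam hlam.nonneg
    refine ⟨isKineticallyStable_of_det_pos hdet htr, ?_⟩
    -- The product `h` of the roots is negative, so they are real and the larger is positive.
    have key : ∀ T h : ℝ, T < 0 → h < 0 → ∃ β : ℝ, 0 < β ∧ β ^ 2 - T * β + h = 0 := by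
      intro T h hT hh
      have hs := Real.sq_sqrt (show 0 ≤ T ^ 2 - 4 * h by nlinarith)
      have hlt : -T < Real.sqrt (T ^ 2 - 4 * h) := Real.lt_sqrt_of_sq_lt (by nlinarith)
      exact ⟨(T + Real.sqrt (T ^ 2 - 4 * h)) / 2, by linarith, by linear_combination hs / 4⟩
    obtain ⟨β, hβ, hquad⟩ := key _ _ hT' hneg
    exact ⟨β, linearizationEigenvalue_of_mode hlam hquad, by simpa using hβ⟩

end Spectrum

end TuringRD

/-! ### Reduction to the two eigenvalues around `kc0`. -/

theorem theorem4p4 {n : ℕ} (Ω : Set (TuringRD.E n)) (hΩo : IsOpen Ω) (hΩc : IsConnected Ω)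
    (hΩb : Bornology.IsBounded Ω) (bc : TuringRD.BoundaryCondition)
    (f g : ℝ → ℝ → ℝ) (hf0 : f 0 0 = 0) (hg0 : g 0 0 = 0)
    (hf : DifferentiableAt ℝ (Function.uncurry f) (0, 0))
    (hg : DifferentiableAt ℝ (Function.uncurry g) (0, 0))
    (A : Matrix (Fin 2) (Fin 2) ℝ) (hA : A = TuringRD.jacobian f g)
    (hdet : 0 < A.det) (htr : A.trace < 0)
    (Du : ℝ) (hDu : 0 < Du) (hDv0 : 0 < TuringRD.Dv0 A Du)
    (lam lam' : ℝ) (hlam : TuringRD.AreConsecutiveEigenvalues Ω bc lam lam')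
    (hk : lam < TuringRD.kc0 A Du) (hk' : TuringRD.kc0 A Du < lam')
    (hM : 0 < (TuringRD.modeMatrix A Du (TuringRD.Dv0 A Du) lam).det)
    (hM' : 0 < (TuringRD.modeMatrix A Du (TuringRD.Dv0 A Du) lam').det) :
    ∀ Dv : ℝ, 0 < Dv →
      (TuringRD.IsTuringUnstable Ω bc f g Du Dv ↔
        TuringRD.DvStar A Du lam lam' < (Dv : EReal)) := by
  subst hA
  intro Dv hDv
  obtain ⟨hev, hev', -, hgap⟩ := hlam
  have hk0 : 0 < TuringRD.kc0 (TuringRD.jacobian f g) Du := hev.nonneg.trans_lt hk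
  have hb := (TuringRD.critical_facts hdet htr hDu hDv0 hk0).1
  rw [TuringRD.isTuringUnstable_iff hdet htr hDu hDv, TuringRD.DvStar, min_lt_iff,
    TuringRD.dvRoot_lt_iff hdet hDu hb hev.nonneg hDv,
    TuringRD.dvRoot_lt_iff hdet hDu hb hev'.nonneg hDv]
  constructor
  · rintro ⟨μ, hμ, hneg⟩
    have hbetween := fun ν => TuringRD.hPoly_neg_of_between (ν := ν) hdet htr hDu hDv0 hk0 hDv
      hμ.nonneg hneg
    -- Consecutiveness puts `lam` or `lam'` between the unstable mode `μ` and `kc0`.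
    rcases hgap μ hμ with h | h
    · exact Or.inl (hbetween _ (Or.inl ⟨h, hk⟩))
    · exact Or.inr (hbetween _ (Or.inr ⟨hk', h⟩))
  · rintro (h | h)
    · exact ⟨lam, hev, h⟩
    · exact ⟨lam', hev', h⟩
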